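/- Consider $m$ data qubits and $n$ ancilla qubits. Let $\mathcal P^m=\{I,X,Y,Z\}^m$ (Pauli operators modulo phase), and let $\langle P,Q\rangle\in\{0,1\}$ be $0$ if $P,Q$ commute and $1$ otherwise. Let $S_1,\dots,S_n\in\mathcal P^m$ commute pairwise (the stabilizers), put $S^k=\prod_i S_i^{k_i}$ for $k\in\mathbb Z_2^n$, and let $G$ be the syndrome-measurement circuit: for $i=1,\dots,n$, a Hadamard gate on ancilla $i$, a controlled-$S_i$ gate with ancilla $i$ as control, and a Hadamard gate on ancilla $i$. **Noise models.** Fix a family $(G_i)$ of Clifford gates on the $n+m$ qubits. A noise model consists of (i) an initial state $\rho$ such that for every subset of the qubits some Pauli operator $R$ that acts non-trivially exactly on this subset has $\mathrm{Tr}(R\rho)\ne 0$; (ii) for every $i$ a Pauli channel that follows $G_i$; (iii) a probability distribution $(p^P_{a,b})_{a,b\in\mathbb Z_2^n,\,P\in\mathcal P^m}$, the Pauli error rates of the mid-circuit measurement (MCM), which with outcome $k\in\mathbb Z_2^n$ acts as $$\mathcal T_k(\sigma)=\sum_{a,b,P}p^P_{a,b}\,(P\otimes|k+b\rangle\langle k+a|)\,G\sigma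 G^\dagger\,(P\otimes|k+a\rangle\langle k+b|);$$ (iv) a Pauli channel $\Lambda_M$ on the $n+m$ qubits that precedes every terminating measurement, and whose Pauli fidelity at $Q$ depends only on the set of qubits on which $Q$ acts non-trivially. The Pauli fidelities are $\lambda^Q=\sum_P(-1)^{\langle P,Q\rangle}p^P$ for a Pauli channel with Pauli error rates $p^P$, and $\lambda^Q_{x,y}=\sum_{a,b,P}(-1)^{a\cdot x+b\cdot y+\langle P,Q\rangle}p^P_{a,b}$ for the MCM. All Pauli error rates and all Pauli fidelities in (ii)--(iv) are strictly positive. **Learnability.** An experiment prepares $\rho$, applies a finite sequence of noiseless layers of single-qubit gates, noisy gates $G_i$ and noisy MCMs, and ends with an arbitrary POVM preceded by $\Lambda_M$. Two noise models are indistinguishable if every experiment has the same joint distribution of the MCM outcomes and the POVM outcome in both. A real function of the noise model is learnable if it takes equal values on any two indistinguishable noise models. **First-order approximation.** Let $$\tilde p^P_{a,b}=\frac1{4^{n+m}}\sum_{x,y\in\mathbb Z_2^n,\,Q\in\mathcal P^m}(-1)^{a\cdot x+b\cdot y+\langle P,Q\rangle}\bigl(1+\log\lambda^Q_{x,y}\bigr).$$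 **Proposition.** For every $P\in\mathcal P^m$ that commutes with $S_1,\dots,S_n$ and every $a\in\mathbb Z_2^n$, $a\neq0$, the sum $\sum_{k\in\mathbb Z_2^n}\bigl(p^{S^kP}_{0,a}+p^{S^kP}_{a,0}\bigr)$ is learnable under the first-order approximation. That is, the function $$\sum_{k\in\mathbb Z_2^n}\bigl(\tilde p^{S^kP}_{0,a}+\tilde p^{S^kP}_{a,0}\bigr)$$ of the noise model is learnable, and for every noise model with $\varepsilon:=1-p^I_{0,0}\le\frac14$ it differs from $\sum_{k}\bigl(p^{S^kP}_{0,a}+p^{S^kP}_{a,0}\bigr)$ by at most $2^{n+3}\varepsilon^2$. -/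

import Mathlib

open scoped Matrix ComplexOrder

noncomputable section

namespace MCM

/-! ### Bit strings, Pauli operators, Clifford gates -/

/-- Bit strings indexed by `q`; they also label the computational basis of the qubits in `q`. -/
abbrev Bits (q : Type) : Type := q → ZMod 2

/-- Operators on the Hilbert space of the qubits in `q`, in the computational basis. -/
abbrev QMat (q : Type) : Type := Matrix (Bits q) (Bits q) ℂ

/-- Pauli operators modulo phase on the qubits in `q`. On every qubit, `(0,0)`, `(1,0)`, `(1,1)`,
`(0,1)` stand for `I`, `X`, `Y`, `Z`. The product modulo phase is the sum, the identity is `0`. -/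
abbrev Pauli (q : Type) : Type := q → ZMod 2 × ZMod 2

/-- The register of an MCM: `m` data qubits and `n` ancilla qubits. -/
abbrev Reg (m n : ℕ) : Type := Fin m ⊕ Fin n

/-- The sign `(-1)^b` of a bit. -/
def sgn (b : ZMod 2) : ℝ := (-1) ^ b.val

/-- The `2 × 2` matrix `i^{xz} X^x Z^z`, that is `I`, `X`, `Y` or `Z`. -/
def sigma (p : ZMod 2 × ZMod 2) : Matrix (ZMod 2) (ZMod 2) ℂ := fun u v =>
  if u = v + p.1 then Complex.I ^ (p.1.val * p.2.val) * (-1) ^ (p.2.val * v.val) else 0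

variable {q : Type} [Fintype q]

/-- The tensor product `⨂ⱼ Aⱼ` of single-qubit operators. -/
def localOp (A : q → Matrix (ZMod 2) (ZMod 2) ℂ) : QMat q := fun u v => ∏ j, A j (u j) (v j)

/-- The matrix of a Pauli operator. -/
def pauliMat (P : Pauli q) : QMat q := localOp fun j => sigma (P j)

/-- The symplectic inner product: `0` if `P` and `Q` commute and `1` otherwise. -/
def symp (P Q : Pauli q) : ZMod 2 := ∑ j, ((P j).1 * (Q j).2 + (P j).2 * (Q j).1)

/-- The Pauli weight pattern. -/
def pt (P : Pauli q) : Bits q := fun j => if P j = 0 then 0 else 1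

variable [DecidableEq q]

/-- Clifford gates: unitaries that map Pauli operators to Pauli operators up to sign. -/
def IsClifford (U : QMat q) : Prop :=
  U ∈ Matrix.unitaryGroup (Bits q) ℂ ∧
    ∀ P : Pauli q, ∃ Q : Pauli q,
      U * pauliMat P * Uᴴ = pauliMat Q ∨ U * pauliMat P * Uᴴ = -pauliMat Q

/-! ### Noise -/

/-- Pauli noise on the qubits in `q`: the Pauli error rates form a probability distribution, the
channel is not at the boundary of the completely positive polytope, and all Pauli fidelities are
strictly positive. -/
structure PauliNoise (q : Type) [Fintype q] [DecidableEq q] where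
  rate : Pauli q → ℝ
  rate_pos : ∀ P, 0 < rate P
  sum_rate : ∑ P, rate P = 1
  fidelity_pos : ∀ Q, 0 < ∑ P, sgn (symp P Q) * rate P

/-- The Pauli fidelity `λ^Q`. -/
def PauliNoise.fidelity (Λ : PauliNoise q) (Q : Pauli q) : ℝ := ∑ P, sgn (symp P Q) * Λ.rate P

/-- The Pauli channel `σ ↦ ∑ P, p^P P σ P†`. -/
def PauliNoise.apply (Λ : PauliNoise q) (σ : QMat q) : QMat q :=
  ∑ P, (Λ.rate P : ℂ) • (pauliMat P * σ * (pauliMat P)ᴴ)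

/-- The Pauli fidelities depend on the Pauli weight pattern only. -/
def PauliNoise.IsSymmetric (Λ : PauliNoise q) : Prop :=
  ∀ Q Q' : Pauli q, pt Q = pt Q' → Λ.fidelity Q = Λ.fidelity Q'

/-- The noise of an MCM with `m` data and `n` ancilla qubits: the Pauli error rates
`rate a b P = p_{a,b}^P` form a probability distribution, the instrument is not at the boundary of
the completely positive polytope, and all Pauli fidelities are strictly positive. -/
structure MCMNoise (m n : ℕ) where
  rate : Bits (Fin n) → Bits (Fin n) → Pauli (Fin m) → ℝ
  rate_pos : ∀ a b P, 0 < rate a b P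
  sum_rate : ∑ a, ∑ b, ∑ P, rate a b P = 1
  fidelity_pos : ∀ x y Q, 0 < ∑ a, ∑ b, ∑ P, sgn (a ⬝ᵥ x + b ⬝ᵥ y + symp P Q) * rate a b P

variable {m n : ℕ}

/-- The Pauli fidelity `λ_{x,y}^Q` of an MCM. -/
def MCMNoise.fidelity (M : MCMNoise m n) (x y : Bits (Fin n)) (Q : Pauli (Fin m)) : ℝ :=
  ∑ a, ∑ b, ∑ P, sgn (a ⬝ᵥ x + b ⬝ᵥ y + symp P Q) * M.rate a b P

/-- The first-order approximation of the Pauli error rate `p_{a,b}^P`: in the inverse Fourier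
transform of the Pauli fidelities, every `λ` is replaced by `1 + log λ`. -/
def MCMNoise.rateApprox (M : MCMNoise m n) (a b : Bits (Fin n)) (P : Pauli (Fin m)) : ℝ :=
  1 / 4 ^ (n + m) * ∑ x, ∑ y, ∑ Q,
    sgn (a ⬝ᵥ x + b ⬝ᵥ y + symp P Q) * (1 + Real.log (M.fidelity x y Q))

/-- The operator `A ⊗ B`, with `A` on the data and `B` on the ancilla qubits. -/
def tens (A : QMat (Fin m)) (B : QMat (Fin n)) : QMat (Reg m n) := fun u v =>
  A (fun i => u (Sum.inl i)) (fun i => v (Sum.inl i)) *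
    B (fun i => u (Sum.inr i)) (fun i => v (Sum.inr i))

/-- The operator `P ⊗ |k+b⟩⟨k+a|`. -/
def krausOp (k a b : Bits (Fin n)) (P : Pauli (Fin m)) : QMat (Reg m n) :=
  tens (pauliMat P) (Matrix.single (k + b) (k + a) 1)

/-- The unnormalized state after outcome `k` of the noisy MCM with ideal Clifford gate `G`:
`G` is applied first, the uniform stochastic instrument follows. -/
def MCMNoise.apply (M : MCMNoise m n) (G : QMat (Reg m n)) (k : Bits (Fin n))
    (σ : QMat (Reg m n)) : QMat (Reg m n) :=
  ∑ a, ∑ b, ∑ P, (M.rate a b P : ℂ) • (krausOp k a b P * (G * σ * Gᴴ) * (krausOp k a b P)ᴴ)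

/-- Noise models, for a family of multi-qubit Clifford gates indexed by `ι`: the initial state, the
Pauli noise of each gate, the noise of the MCM, and the symmetric Pauli noise of the terminating
measurement. The initial state has non-zero overlap with some Pauli operator of every pattern;
otherwise part of the noise never shows up in any experiment. -/
structure NoiseModel (m n : ℕ) (ι : Type*) where
  state : QMat (Reg m n)
  state_posSemidef : state.PosSemidef
  state_trace : state.trace = 1
  state_overlap : ∀ v : Bits (Reg m n), ∃ R : Pauli (Reg m n),
    pt R = v ∧ (pauliMat R * state).trace ≠ 0
  gateNoise : ι → PauliNoise (Reg m n)
  mcm : MCMNoise m n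
  measNoise : PauliNoise (Reg m n)
  measNoise_symm : measNoise.IsSymmetric

/-! ### Experiments and learnability -/

/-- The gates of an experiment: a layer of arbitrary single-qubit gates, or one of the multi-qubit
Clifford gates. -/
inductive Gate (m n : ℕ) (ι : Type*) where
  | single (V : Reg m n → Matrix.unitaryGroup (ZMod 2) ℂ) : Gate m n ι
  | multi (i : ι) : Gate m n ι

variable {ι : Type*}

/-- The action of a gate: single-qubit gates are noiseless, multi-qubit Clifford gates are followed
by their Pauli noise. -/
def NoiseModel.applyGate (U : ι → QMat (Reg m n)) (N : NoiseModel m n ι) :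
    Gate m n ι → QMat (Reg m n) → QMat (Reg m n)
  | .single V, σ => localOp (fun j => (V j).1) * σ * (localOp fun j => (V j).1)ᴴ
  | .multi i, σ => (N.gateNoise i).apply (U i * σ * (U i)ᴴ)

/-- A list of gates, the head being applied first. -/
def NoiseModel.applyGates (U : ι → QMat (Reg m n)) (N : NoiseModel m n ι)
    (l : List (Gate m n ι)) (σ : QMat (Reg m n)) : QMat (Reg m n) :=
  l.foldl (fun τ g => N.applyGate U g τ) σ

/-- The unnormalized state after the gates `C 0`, an MCM with outcome `k 0`, the gates `C 1`, an
MCM with outcome `k 1`, and so on, up to the gates `C d`. -/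
def NoiseModel.run (U : ι → QMat (Reg m n)) (G : QMat (Reg m n)) (N : NoiseModel m n ι) :
    (d : ℕ) → (Fin (d + 1) → List (Gate m n ι)) → (Fin d → Bits (Fin n)) →
      QMat (Reg m n) → QMat (Reg m n)
  | 0, C, _, σ => N.applyGates U (C 0) σ
  | d + 1, C, k, σ =>
      N.run U G d (fun i => C i.succ) (fun i => k i.succ)
        (N.mcm.apply G (k 0) (N.applyGates U (C 0) σ))

/-- An experiment: a sequence of gates with `numMCM` MCMs in between, and a terminating POVM. -/
structure Experiment (m n : ℕ) (ι : Type*) where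
  numMCM : ℕ
  gates : Fin (numMCM + 1) → List (Gate m n ι)
  numOutcomes : ℕ
  effect : Fin numOutcomes → QMat (Reg m n)
  effect_posSemidef : ∀ j, (effect j).PosSemidef
  sum_effect : ∑ j, effect j = 1

/-- The probability of the MCM outcomes `k` and the outcome `j` of the terminating measurement. -/
def NoiseModel.prob (U : ι → QMat (Reg m n)) (G : QMat (Reg m n)) (N : NoiseModel m n ι)
    (X : Experiment m n ι) (k : Fin X.numMCM → Bits (Fin n)) (j : Fin X.numOutcomes) : ℝ :=
  (X.effect j * N.measNoise.apply (N.run U G X.numMCM X.gates k N.state)).trace.re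

/-- Two noise models are indistinguishable if every experiment has the same outcome distribution
in both. -/
def Indistinguishable (U : ι → QMat (Reg m n)) (G : QMat (Reg m n))
    (N₁ N₂ : NoiseModel m n ι) : Prop :=
  ∀ (X : Experiment m n ι) (k : Fin X.numMCM → Bits (Fin n)) (j : Fin X.numOutcomes),
    N₁.prob U G X k j = N₂.prob U G X k j

/-- A function of the noise model is learnable if it agrees on indistinguishable noise models. -/
def Learnable (U : ι → QMat (Reg m n)) (G : QMat (Reg m n)) (f : NoiseModel m n ι → ℝ) : Prop :=
  ∀ N₁ N₂ : NoiseModel m n ι, Indistinguishable U G N₁ N₂ → f N₁ = f N₂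

/-! ### Syndrome measurements -/

/-- The Hadamard gate. -/
def hadamard : Matrix (ZMod 2) (ZMod 2) ℂ := fun u v => (-1) ^ (u.val * v.val) / (Real.sqrt 2 : ℂ)

/-- The Hadamard gate on ancilla `i`. -/
def ancillaH (m : ℕ) (i : Fin n) : QMat (Reg m n) :=
  tens 1 (localOp (Function.update (fun _ => 1) i hadamard))

/-- The controlled-`S` gate with ancilla `i` as control and the data qubits as target. -/
def controlledPauli (i : Fin n) (S : Pauli (Fin m)) : QMat (Reg m n) :=
  tens 1 (Matrix.diagonal fun w => if w i = 0 then 1 else 0) +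
    tens (pauliMat S) (Matrix.diagonal fun w => if w i = 1 then 1 else 0)

/-- The gate of the simultaneous measurement of `S₁, …, Sₙ`: for `i = 1, …, n` in this temporal
order, a Hadamard gate on ancilla `i`, controlled-`Sᵢ`, and a Hadamard gate on ancilla `i`. -/
def syndromeGate (S : Fin n → Pauli (Fin m)) : QMat (Reg m n) :=
  (List.ofFn fun i => ancillaH m i * controlledPauli i (S i) * ancillaH m i).reverse.prod

/-- The product `S^k = ∏ i, Sᵢ^{kᵢ}`, modulo phase. -/
def stabPow (S : Fin n → Pauli (Fin m)) (k : Bits (Fin n)) : Pauli (Fin m) :=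
  ∑ i, if k i = 1 then S i else 0

/-- The Pauli operators that commute with all stabilizers. -/
def centralizer (S : Fin n → Pauli (Fin m)) : Set (Pauli (Fin m)) :=
  {P | ∀ i, symp P (S i) = 0}

end MCM

end

open MCM

/-! Conjugation by the syndrome circuit sends `Q ⊗ Z^x`, for `Q` in the centralizer of the
stabilizers, to `Q S^x ⊗ Z^x` up to a phase (`syndromeGate_conj`). If a Pauli measurement of `Q ⊗
Z^y` follows one MCM, the Fourier transform over the outcome at frequency `x + y` isolates
`λ^Q_{x,y}`, times a state overlap at the pattern of `Q S^x ⊗ Z^x` and a measurement fidelity at `Q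
⊗ Z^y`. The experiment without MCM fixes the product of overlap and measurement fidelity. Hence,
between indistinguishable models, `log λ^Q_{x,y}` changes by `f(Q S^x, x) - f(Q, y)`, where `f(Q,
y)` is the change of the log measurement fidelity at `Q ⊗ Z^y`
(`Indistinguishable.log_fidelity_sub`).

In the sum of approximate rates, averaging over `S^k` removes every `Q` outside the centralizer. The
remaining weight is invariant under `Q ↦ Q S^x`, so summing over `Q` turns the change into `F x - F
y`. This is antisymmetric in `x, y`, whereas adding `p_{0,a}` and `p_{a,0}` produces the symmetric
weight `(-1)^{a·y} + (-1)^{a·x}`; the total vanishes (`sum_coboundary_eq_zero`).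

For the error bound, all fidelities lie in `[1 - 2ε, 1]`, where `1 + log λ` is within `(1 - λ)^2 ≤
4ε^2` of `λ`. Fourier inversion averages these errors, and `2 · 2^n` rates are summed. -/

namespace MCM

/-! ### Sign characters and the symplectic form. -/

section Signs

theorem zmod_two_cases (b : ZMod 2) : b = 0 ∨ b = 1 := by
  revert b; decide

theorem sum_zmod_two {M : Type*} [AddCommMonoid M] (f : ZMod 2 → M) : ∑ i, f i = f 0 + f 1 :=
  Fin.sum_univ_two f

theorem val_zmod_two_one : (1 : ZMod 2).val = 1 := rfl

theorem add_self_zmod_two (b : ZMod 2) : b + b = 0 := by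
  revert b; decide

theorem sgn_zero : sgn 0 = 1 := by simp [sgn]

theorem sgn_one : sgn 1 = -1 := by simp [sgn, val_zmod_two_one]

theorem sgn_add (a b : ZMod 2) : sgn (a + b) = sgn a * sgn b := by
  rcases zmod_two_cases a with rfl | rfl <;> rcases zmod_two_cases b with rfl | rfl <;>
    simp [sgn_zero, sgn_one, add_self_zmod_two]

theorem abs_sgn (a : ZMod 2) : |sgn a| = 1 := by
  rcases zmod_two_cases a with rfl | rfl <;> simp [sgn_zero, sgn_one]

theorem sgn_sum {α : Type*} (s : Finset α) (f : α → ZMod 2) :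
    sgn (∑ i ∈ s, f i) = ∏ i ∈ s, sgn (f i) := by
  classical
  induction s using Finset.induction_on with
  | empty => simp [sgn_zero]
  | insert i s hi ih => rw [Finset.sum_insert hi, Finset.prod_insert hi, sgn_add, ih]

/-- A sign character that is not trivial sums to zero. -/
theorem sum_sgn_eq_zero {V : Type*} [AddCommGroup V] [Fintype V] (f : V → ZMod 2)
    (hf : ∀ u v, f (u + v) = f u + f v) (w : V) (hw : f w = 1) : ∑ v, sgn (f v) = 0 := by
  -- Translation by `w` permutes the terms and flips every sign.
  have h : ∑ v, sgn (f (v + w)) = ∑ v, sgn (f v) :=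
    Fintype.sum_equiv (Equiv.addRight w) _ _ fun v => rfl
  simp only [hf, hw, sgn_add, sgn_one, mul_neg, mul_one, Finset.sum_neg_distrib] at h
  linarith

theorem sum_sgn_dotProduct {n : ℕ} {s : Bits (Fin n)} (hs : s ≠ 0) :
    ∑ x : Bits (Fin n), sgn (s ⬝ᵥ x) = 0 := by
  obtain ⟨i, hi⟩ := Function.ne_iff.mp hs
  refine sum_sgn_eq_zero _ (fun u v => dotProduct_add s u v) (Pi.single i 1) ?_
  rw [dotProduct_single, mul_one]
  exact (zmod_two_cases (s i)).resolve_left hi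

variable {q : Type} [Fintype q]

theorem symp_add_left (P P' Q : Pauli q) : symp (P + P') Q = symp P Q + symp P' Q := by
  simp only [symp, ← Finset.sum_add_distrib]
  refine Finset.sum_congr rfl fun j _ => ?_
  simp only [Pi.add_apply, Prod.fst_add, Prod.snd_add]
  ring

theorem symp_comm (P Q : Pauli q) : symp P Q = symp Q P := by
  simp only [symp]
  refine Finset.sum_congr rfl fun j _ => ?_
  ring

theorem symp_add_right (P Q Q' : Pauli q) : symp P (Q + Q') = symp P Q + symp P Q' := by
  rw [symp_comm, symp_add_left, symp_comm Q, symp_comm Q']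

theorem symp_zero_left (Q : Pauli q) : symp 0 Q = 0 := by simp [symp]

theorem symp_sum_right {α : Type*} (s : Finset α) (P : Pauli q) (f : α → Pauli q) :
    symp P (∑ i ∈ s, f i) = ∑ i ∈ s, symp P (f i) :=
  map_sum (AddMonoidHom.mk' (symp P) (symp_add_right P)) f s

theorem sum_sgn_symp [DecidableEq q] {P : Pauli q} (hP : P ≠ 0) :
    ∑ Q : Pauli q, sgn (symp P Q) = 0 := by
  obtain ⟨i, hi⟩ := Function.ne_iff.mp hP
  have h : ∃ r : ZMod 2 × ZMod 2, (P i).1 * r.2 + (P i).2 * r.1 = 1 := by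
    generalize P i = p at hi
    simp only [Pi.zero_apply] at hi
    revert p; decide
  obtain ⟨r, hr⟩ := h
  refine sum_sgn_eq_zero _ (fun u v => symp_add_right P u v) (Pi.single i r) ?_
  rw [symp, Finset.sum_eq_single i]
  · simpa using hr
  · intro j _ hj
    simp [Pi.single_eq_of_ne hj]
  · simp

end Signs

/-! ### Single-qubit Pauli algebra and tensor products of local operators. -/

section LocalOperators

variable {q : Type} [Fintype q]

theorem localOp_conjTranspose (A : q → Matrix (ZMod 2) (ZMod 2) ℂ) :
    (localOp A)ᴴ = localOp fun j => (A j)ᴴ := by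
  ext u v
  simp [localOp, Matrix.conjTranspose_apply]

theorem localOp_one : localOp (fun _ : q => (1 : Matrix (ZMod 2) (ZMod 2) ℂ)) = 1 := by
  ext u v
  simp only [localOp, Matrix.one_apply]
  rw [Fintype.prod_ite_zero]
  simp [funext_iff]

theorem localOp_smul (c : q → ℂ) (A : q → Matrix (ZMod 2) (ZMod 2) ℂ) :
    localOp (fun j => c j • A j) = (∏ j, c j) • localOp A := by
  ext u v
  simp [localOp, Finset.prod_mul_distrib]

variable [DecidableEq q]

theorem localOp_mul (A B : q → Matrix (ZMod 2) (ZMod 2) ℂ) :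
    localOp A * localOp B = localOp fun j => A j * B j := by
  ext u v
  simp only [localOp, Matrix.mul_apply, ← Finset.prod_mul_distrib]
  rw [Finset.prod_univ_sum, Fintype.piFinset_univ]

theorem sigma_zero : sigma 0 = 1 := by
  ext u v
  simp [sigma, Matrix.one_apply]

theorem sigma_conjTranspose (p : ZMod 2 × ZMod 2) : (sigma p)ᴴ = sigma p := by
  obtain ⟨s, t⟩ := p
  ext u v
  rcases zmod_two_cases s with rfl | rfl <;> rcases zmod_two_cases t with rfl | rfl <;>
  rcases zmod_two_cases u with rfl | rfl <;> rcases zmod_two_cases v with rfl | rfl <;>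
  simp [sigma, Matrix.conjTranspose_apply, val_zmod_two_one, add_self_zmod_two]

theorem sigma_mul (p r : ZMod 2 × ZMod 2) :
    ∃ c : ℂ, c ≠ 0 ∧ sigma p * sigma r = c • sigma (p + r) := by
  obtain ⟨s, t⟩ := p
  obtain ⟨s', t'⟩ := r
  -- The phases of the two factors, the sign from moving `Z^t` past `X^{s'}`, and division by the
  -- phase built into `sigma (p + r)`.
  refine ⟨Complex.I ^ (s.val * t.val) * Complex.I ^ (s'.val * t'.val) * (-1) ^ (t.val * s'.val) /
    Complex.I ^ ((s + s').val * (t + t').val), by simp, ?_⟩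
  ext u v
  rcases zmod_two_cases s with rfl | rfl <;> rcases zmod_two_cases t with rfl | rfl <;>
  rcases zmod_two_cases s' with rfl | rfl <;> rcases zmod_two_cases t' with rfl | rfl <;>
  rcases zmod_two_cases u with rfl | rfl <;> rcases zmod_two_cases v with rfl | rfl <;>
  simp [sigma, Matrix.mul_apply, val_zmod_two_one, add_self_zmod_two]

theorem sigma_mul_self (p : ZMod 2 × ZMod 2) : sigma p * sigma p = 1 := by
  obtain ⟨s, t⟩ := p
  ext u v
  rcases zmod_two_cases s with rfl | rfl <;> rcases zmod_two_cases t with rfl | rfl <;>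
  rcases zmod_two_cases u with rfl | rfl <;> rcases zmod_two_cases v with rfl | rfl <;>
  simp [sigma, Matrix.mul_apply, val_zmod_two_one, add_self_zmod_two]

theorem sigma_mul_comm (p r : ZMod 2 × ZMod 2) :
    sigma p * sigma r = (sgn (p.1 * r.2 + p.2 * r.1) : ℂ) • (sigma r * sigma p) := by
  obtain ⟨s, t⟩ := p
  obtain ⟨s', t'⟩ := r
  ext u v
  rcases zmod_two_cases s with rfl | rfl <;> rcases zmod_two_cases t with rfl | rfl <;>
  rcases zmod_two_cases s' with rfl | rfl <;> rcases zmod_two_cases t' with rfl | rfl <;>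
  rcases zmod_two_cases u with rfl | rfl <;> rcases zmod_two_cases v with rfl | rfl <;>
  simp [sigma, Matrix.mul_apply, val_zmod_two_one, add_self_zmod_two, sgn_zero,
    sgn_one]

/-- Any two non-trivial single-qubit Pauli operators are related by a unitary. -/
theorem exists_unitary_sigma (p r : ZMod 2 × ZMod 2) (h : p = 0 ↔ r = 0) :
    ∃ V : Matrix.unitaryGroup (ZMod 2) ℂ, V.1ᴴ * sigma r * V.1 = sigma p := by
  by_cases hpr : p = r
  · exact ⟨1, by simp [hpr]⟩
  have hanti : sigma r * sigma p = -(sigma p * sigma r) := by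
    have hs : r.1 * p.2 + r.2 * p.1 = 1 := by revert p r; decide
    rw [sigma_mul_comm, hs, sgn_one]
    simp
  -- Distinct non-trivial Paulis anticommute, so their normalized sum is a reflection that exchanges
  -- them; the Hadamard gate is the case of `X` and `Z`.
  set V : Matrix (ZMod 2) (ZMod 2) ℂ := ((Real.sqrt 2 : ℂ)⁻¹) • (sigma p + sigma r) with hV
  have h2 : ((Real.sqrt 2 : ℂ)⁻¹) * ((Real.sqrt 2 : ℂ)⁻¹) = 1 / 2 := by
    rw [← mul_inv, ← Complex.ofReal_mul, Real.mul_self_sqrt (by norm_num)]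
    norm_num
  have hVH : Vᴴ = V := by
    rw [hV, Matrix.conjTranspose_smul, Matrix.conjTranspose_add, sigma_conjTranspose,
      sigma_conjTranspose]
    simp
  have hVV : V * V = 1 := by
    rw [hV, smul_mul_smul_comm, h2, add_mul, mul_add, mul_add, sigma_mul_self, sigma_mul_self,
      hanti]
    rw [show (1 + sigma p * sigma r + (-(sigma p * sigma r) + 1) : Matrix (ZMod 2) (ZMod 2) ℂ)
      = (2 : ℂ) • 1 by rw [two_smul]; abel, smul_smul]
    norm_num
  refine ⟨⟨V, Matrix.mem_unitaryGroup_iff.mpr ?_⟩, ?_⟩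
  · rw [Matrix.star_eq_conjTranspose, hVH, hVV]
  · change Vᴴ * sigma r * V = sigma p
    have hVr : sigma r * V = V * sigma p := by
      rw [hV, mul_smul_comm, smul_mul_assoc, add_mul, mul_add, sigma_mul_self, sigma_mul_self,
        add_comm]
    rw [hVH, mul_assoc, hVr, ← mul_assoc, hVV, one_mul]

end LocalOperators

/-! ### Pauli matrices on many qubits and the action of Pauli channels. -/

section PauliMatrices

variable {q : Type} [Fintype q]

theorem pauliMat_zero : pauliMat (0 : Pauli q) = 1 := by
  simp [pauliMat, sigma_zero, localOp_one]

/-- Probabilities are defined by real parts; this recovers the full complex traces from them. -/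
theorem trace_mul_re_of_isHermitian [DecidableEq q] {A B : QMat q} (hA : Aᴴ = A) (hB : Bᴴ = B) :
    (((A * B).trace.re : ℝ) : ℂ) = (A * B).trace := by
  rw [← Complex.conj_eq_iff_re, starRingEnd_apply, ← Matrix.trace_conjTranspose, Matrix.conjTranspose_mul, hA, hB, Matrix.trace_mul_comm]

theorem pauliMat_conjTranspose (P : Pauli q) : (pauliMat P)ᴴ = pauliMat P := by
  simp [pauliMat, localOp_conjTranspose, sigma_conjTranspose]

variable [DecidableEq q]

theorem pauliMat_mul_self (P : Pauli q) : pauliMat P * pauliMat P = 1 := by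
  simp [pauliMat, localOp_mul, sigma_mul_self, localOp_one]

theorem pauliMat_mul (P Q : Pauli q) :
    ∃ c : ℂ, c ≠ 0 ∧ pauliMat P * pauliMat Q = c • pauliMat (P + Q) := by
  choose c hc h using fun j => sigma_mul (P j) (Q j)
  refine ⟨∏ j, c j, Finset.prod_ne_zero_iff.mpr fun j _ => hc j, ?_⟩
  simp only [pauliMat, localOp_mul, h, localOp_smul, Pi.add_apply]

theorem pauliMat_mul_comm (P Q : Pauli q) :
    pauliMat P * pauliMat Q = (sgn (symp P Q) : ℂ) • (pauliMat Q * pauliMat P) := by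
  simp only [pauliMat, localOp_mul, symp, sgn_sum, Complex.ofReal_prod, ← localOp_smul]
  congr 1
  ext1 j
  exact sigma_mul_comm _ _

theorem pauliMat_conj (P Q : Pauli q) :
    (pauliMat P)ᴴ * pauliMat Q * pauliMat P = (sgn (symp P Q) : ℂ) • pauliMat Q := by
  rw [pauliMat_conjTranspose, pauliMat_mul_comm, smul_mul_assoc, mul_assoc, pauliMat_mul_self,
    mul_one]

theorem PauliNoise.trace_pauliMat_mul_apply (Λ : PauliNoise q) (Q : Pauli q) (σ : QMat q) :
    (pauliMat Q * Λ.apply σ).trace = Λ.fidelity Q * (pauliMat Q * σ).trace := by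
  simp only [PauliNoise.apply, PauliNoise.fidelity, Finset.mul_sum, Matrix.trace_sum,
    Complex.ofReal_sum, Finset.sum_mul]
  refine Finset.sum_congr rfl fun P _ => ?_
  rw [mul_smul_comm, Matrix.trace_smul, ← mul_assoc, Matrix.trace_mul_comm, ← mul_assoc,
    ← mul_assoc, pauliMat_conj, smul_mul_assoc, Matrix.trace_smul]
  simp only [smul_eq_mul, Complex.ofReal_mul]
  ring

/-- Pauli operators with the same pattern are related by a layer of single-qubit gates. -/
theorem exists_localOp_pauliMat {R T : Pauli q} (h : pt R = pt T) :
    ∃ V : q → Matrix.unitaryGroup (ZMod 2) ℂ,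
      (localOp fun j => (V j).1)ᴴ * pauliMat T * (localOp fun j => (V j).1) = pauliMat R := by
  have h0 : ∀ j, R j = 0 ↔ T j = 0 := fun j => by
    have := congrFun h j
    simp only [pt] at this
    by_cases h1 : R j = 0 <;> by_cases h2 : T j = 0 <;> simp_all
  choose V hV using fun j => exists_unitary_sigma (R j) (T j) (h0 j)
  exact ⟨V, by simp only [pauliMat, localOp_conjTranspose, localOp_mul, hV]⟩

end PauliMatrices

/-! ### The splitting into data and ancilla qubits. -/

section Tensor

variable {m n : ℕ}

theorem tens_mul (A A' : QMat (Fin m)) (B B' : QMat (Fin n)) :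
    tens A B * tens A' B' = tens (A * A') (B * B') := by
  ext u v
  simp only [tens, Matrix.mul_apply]
  rw [← (Equiv.sumArrowEquivProdArrow (Fin m) (Fin n) (ZMod 2)).symm.sum_comp,
    Fintype.sum_prod_type, Finset.sum_mul_sum]
  refine Finset.sum_congr rfl fun w _ => Finset.sum_congr rfl fun w' _ => ?_
  simp only [Equiv.sumArrowEquivProdArrow_symm_apply_inl,
    Equiv.sumArrowEquivProdArrow_symm_apply_inr]
  ring

theorem tens_conjTranspose (A : QMat (Fin m)) (B : QMat (Fin n)) : (tens A B)ᴴ = tens Aᴴ Bᴴ := by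
  ext u v
  simp [tens, Matrix.conjTranspose_apply]

theorem tens_add (A : QMat (Fin m)) (B B' : QMat (Fin n)) :
    tens A (B + B') = tens A B + tens A B' := by
  ext u v
  simp [tens, mul_add]

theorem tens_sub (A : QMat (Fin m)) (B B' : QMat (Fin n)) :
    tens A (B - B') = tens A B - tens A B' := by
  ext u v
  simp [tens, mul_sub]

theorem tens_smul (c : ℂ) (A : QMat (Fin m)) (B : QMat (Fin n)) :
    tens A (c • B) = c • tens A B := by
  ext u v
  simp only [tens, Matrix.smul_apply, smul_eq_mul]
  ring

theorem smul_tens (c : ℂ) (A : QMat (Fin m)) (B : QMat (Fin n)) :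
    tens (c • A) B = c • tens A B := by
  ext u v
  simp only [tens, Matrix.smul_apply, smul_eq_mul]
  ring

theorem tens_sum {α : Type*} (s : Finset α) (A : QMat (Fin m)) (B : α → QMat (Fin n)) :
    tens A (∑ i ∈ s, B i) = ∑ i ∈ s, tens A (B i) := by
  ext u v
  simp [tens, Matrix.sum_apply, Finset.mul_sum]

theorem pauliMat_sumElim (P : Pauli (Fin m)) (R : Pauli (Fin n)) :
    pauliMat (Sum.elim P R : Pauli (Reg m n)) = tens (pauliMat P) (pauliMat R) := by
  ext u v
  simp [pauliMat, localOp, tens, Fintype.prod_sum_type]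

theorem symp_sumElim (P P' : Pauli (Fin m)) (R R' : Pauli (Fin n)) :
    symp (Sum.elim P R : Pauli (Reg m n)) (Sum.elim P' R') = symp P P' + symp R R' := by
  simp [symp, Fintype.sum_sum_type]

end Tensor

/-! ### Pauli fidelities of the mid-circuit measurement. -/

section MidCircuitMeasurement

variable {m n : ℕ}

/-- The Pauli operator `Z^x`. -/
def zPauli (x : Bits (Fin n)) : Pauli (Fin n) := fun j => (0, x j)

theorem pauliMat_zPauli (x : Bits (Fin n)) :
    pauliMat (zPauli x) = Matrix.diagonal fun w => (sgn (w ⬝ᵥ x) : ℂ) := by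
  ext u v
  by_cases h : u = v
  · subst h
    simp only [Matrix.diagonal_apply_eq, dotProduct, sgn_sum, Complex.ofReal_prod]
    change ∏ j, sigma (zPauli x j) (u j) (u j) = _
    refine Finset.prod_congr rfl fun j _ => ?_
    simp only [zPauli, sigma]
    rcases zmod_two_cases (u j) with hu | hu <;> rcases zmod_two_cases (x j) with hx | hx <;>
      simp [hu, hx, sgn_zero, sgn_one, val_zmod_two_one]
  · rw [Matrix.diagonal_apply_ne _ h]
    obtain ⟨j, hj⟩ := Function.ne_iff.mp h
    exact Finset.prod_eq_zero (Finset.mem_univ j) (by simp [sigma, zPauli, hj])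

theorem single_mul_diagonal_mul_single {α : Type*} [Fintype α] [DecidableEq α] (i j k : α)
    (d : α → ℂ) : Matrix.single i j 1 * Matrix.diagonal d * Matrix.single j k 1 =
      d j • Matrix.single i k (1 : ℂ) := by
  have h : Matrix.diagonal d * Matrix.single j k 1 = d j • Matrix.single j k (1 : ℂ) := by
    ext u v
    rw [Matrix.diagonal_mul]
    by_cases hu : j = u
    · subst hu; simp
    · simp [hu]
  rw [mul_assoc, h, mul_smul_comm, Matrix.single_mul_single_same, one_mul]

theorem krausOp_conj (k a b y : Bits (Fin n)) (P Q : Pauli (Fin m)) :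
    (krausOp k a b P)ᴴ * pauliMat (Sum.elim Q (zPauli y)) * krausOp k a b P =
      (sgn (symp P Q) * sgn ((k + b) ⬝ᵥ y) : ℂ) •
        tens (pauliMat Q) (Matrix.single (k + a) (k + a) 1) := by
  rw [krausOp, pauliMat_sumElim, tens_conjTranspose, tens_mul, tens_mul, pauliMat_conj,
    pauliMat_zPauli, Matrix.conjTranspose_single, star_one, single_mul_diagonal_mul_single,
    smul_tens, tens_smul, smul_smul]

/-- Frequency `x + y` is the right one: with `w = k + a`, the terms `w·y` and `a·y` each occur twice
and cancel, leaving `w·x + a·x + b·y`. -/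
theorem sum_sgn_smul_single (a b x y : Bits (Fin n)) :
    ∑ k : Bits (Fin n), (sgn (k ⬝ᵥ (x + y)) * sgn ((k + b) ⬝ᵥ y) : ℂ) •
        Matrix.single (k + a) (k + a) (1 : ℂ) =
      (sgn (a ⬝ᵥ x + b ⬝ᵥ y) : ℂ) • pauliMat (zPauli x) := by
  have haa : ∀ w : Bits (Fin n), w + a + a = w := fun w => by
    ext j; simp [add_assoc, add_self_zmod_two]
  rw [pauliMat_zPauli, ← Matrix.diagonal_smul]
  rw [← Equiv.sum_comp (Equiv.addRight a)]
  simp only [Equiv.coe_addRight, haa]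
  rw [← Matrix.sum_single_eq_diagonal]
  refine Finset.sum_congr rfl fun w _ => ?_
  rw [Matrix.smul_single]
  congr 1
  simp only [smul_eq_mul, mul_one, Pi.smul_apply, ← Complex.ofReal_mul, ← sgn_add, Complex.ofReal_inj]
  congr 1
  simp only [add_dotProduct, dotProduct_add]
  linear_combination add_self_zmod_two (w ⬝ᵥ y) + add_self_zmod_two (a ⬝ᵥ y)

/-- The Fourier transform over the outcome of a mid-circuit measurement extracts a single Pauli
fidelity. -/
theorem MCMNoise.sum_sgn_mul_trace_apply (M : MCMNoise m n) (G σ : QMat (Reg m n))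
    (x y : Bits (Fin n)) (Q : Pauli (Fin m)) :
    ∑ k : Bits (Fin n), (sgn (k ⬝ᵥ (x + y)) : ℂ) *
        (pauliMat (Sum.elim Q (zPauli y)) * M.apply G k σ).trace =
      M.fidelity x y Q * (Gᴴ * pauliMat (Sum.elim Q (zPauli x)) * G * σ).trace := by
  set τ := G * σ * Gᴴ with hτ
  -- Heisenberg picture: the Kraus operators are moved onto the Pauli observable.
  have hk : ∀ k a b P, (pauliMat (Sum.elim Q (zPauli y)) *
      (krausOp k a b P * τ * (krausOp k a b P)ᴴ)).trace =
      (sgn (symp P Q) : ℂ) * (tens (pauliMat Q) ((sgn ((k + b) ⬝ᵥ y) : ℂ) •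
        Matrix.single (k + a) (k + a) 1) * τ).trace := fun k a b P => by
    rw [← mul_assoc, Matrix.trace_mul_comm, ← mul_assoc, ← mul_assoc, krausOp_conj, mul_smul,
      smul_mul_assoc, Matrix.trace_smul, smul_eq_mul, tens_smul]
  have hτ' : (Gᴴ * pauliMat (Sum.elim Q (zPauli x)) * G * σ).trace =
      (tens (pauliMat Q) (pauliMat (zPauli x)) * τ).trace := by
    rw [hτ, pauliMat_sumElim, mul_assoc Gᴴ, mul_assoc Gᴴ, Matrix.trace_mul_comm]
    simp only [mul_assoc]
  rw [hτ']
  simp only [MCMNoise.apply, MCMNoise.fidelity, Finset.mul_sum, Matrix.trace_sum, mul_smul_comm,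
    Matrix.trace_smul, Complex.ofReal_sum, Finset.sum_mul]
  rw [Finset.sum_comm]
  refine Finset.sum_congr rfl fun a _ => ?_
  rw [Finset.sum_comm]
  refine Finset.sum_congr rfl fun b _ => ?_
  rw [Finset.sum_comm]
  refine Finset.sum_congr rfl fun P _ => ?_
  calc _ = (M.rate a b P * sgn (symp P Q) : ℂ) * (tens (pauliMat Q)
      (∑ k : Bits (Fin n), (sgn (k ⬝ᵥ (x + y)) * sgn ((k + b) ⬝ᵥ y) : ℂ) •
        Matrix.single (k + a) (k + a) (1 : ℂ)) * τ).trace := by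
        rw [tens_sum, Finset.sum_mul, Matrix.trace_sum, Finset.mul_sum]
        refine Finset.sum_congr rfl fun k _ => ?_
        rw [hk]
        simp only [tens_smul, smul_mul_assoc, Matrix.trace_smul, smul_eq_mul]
        ring
    _ = _ := by
        rw [sum_sgn_smul_single, tens_smul, smul_mul_assoc, Matrix.trace_smul, sgn_add _ (symp P Q)]
        simp only [smul_eq_mul, Complex.ofReal_mul]
        ring

end MidCircuitMeasurement

/-! ### Conjugation of Pauli operators by the syndrome circuit. -/

section SyndromeGate

/-- Conjugation by the Clifford unitary `(1 + A + B - AB) / 2` given by commuting reflections. -/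
theorem conj_eq_self_of_commute {R : Type*} [Ring R] {A B W : R} (hA : A * A = 1) (hB : B * B = 1)
    (hAB : B * A = A * B) (hAW : A * W = W * A) (hBW : B * W = W * B) :
    (1 + A + B - A * B) * W * (1 + A + B - A * B) = 4 * W := by
  have hA' : ∀ x, A * (A * x) = x := fun x => by rw [← mul_assoc, hA, one_mul]
  have hAB' : ∀ x, B * (A * x) = A * (B * x) := fun x => by rw [← mul_assoc, hAB, mul_assoc]
  have hAW' : ∀ x, A * (W * x) = W * (A * x) := fun x => by rw [← mul_assoc, hAW, mul_assoc]
  simp only [add_mul, mul_add, sub_mul, mul_sub, mul_assoc, one_mul, mul_one, hA, hB, hAB, hAW,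
    hBW, hA', hAB', hAW']
  rw [show (4 : R) = 1 + 1 + 1 + 1 by norm_num]
  noncomm_ring

/-- `(1 + A + B - AB) / 2` is `1` where `B = 1` and `A` where `B = -1`. An operator anticommuting
with `B` swaps the two eigenspaces, so exactly one factor `A` survives. -/
theorem conj_eq_mul_of_anticommute {R : Type*} [Ring R] {A B W : R} (hA : A * A = 1)
    (hB : B * B = 1) (hAB : B * A = A * B) (hAW : A * W = W * A) (hBW : B * W = -(W * B)) :
    (1 + A + B - A * B) * W * (1 + A + B - A * B) = 4 * (W * A) := by
  have hA' : ∀ x, A * (A * x) = x := fun x => by rw [← mul_assoc, hA, one_mul]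
  have hAB' : ∀ x, B * (A * x) = A * (B * x) := fun x => by rw [← mul_assoc, hAB, mul_assoc]
  have hAW' : ∀ x, A * (W * x) = W * (A * x) := fun x => by rw [← mul_assoc, hAW, mul_assoc]
  simp only [add_mul, mul_add, sub_mul, mul_sub, mul_assoc, one_mul, mul_one, hA, hB, hAB, hAW,
    hBW, hA', hAB', hAW', mul_neg, neg_mul]
  rw [show (4 : R) = 1 + 1 + 1 + 1 by norm_num]
  noncomm_ring

variable {m n : ℕ}

theorem pauliMat_single (i : Fin n) (p : ZMod 2 × ZMod 2) :
    pauliMat (Pi.single i p : Pauli (Fin n)) =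
      localOp (Function.update (fun _ => 1) i (sigma p)) := by
  rw [pauliMat]
  congr 1
  ext1 j
  by_cases h : j = i
  · subst h; simp
  · simp [h, sigma_zero]

theorem hadamard_mul_self : hadamard * hadamard = 1 := by
  have h2 : ((Real.sqrt 2 : ℂ)⁻¹) * ((Real.sqrt 2 : ℂ)⁻¹) = 1 / 2 := by
    rw [← mul_inv, ← Complex.ofReal_mul, Real.mul_self_sqrt (by norm_num)]
    norm_num
  ext u v
  rcases zmod_two_cases u with rfl | rfl <;> rcases zmod_two_cases v with rfl | rfl <;>
  simp [hadamard, Matrix.mul_apply, sum_zmod_two, val_zmod_two_one, div_eq_mul_inv, h2] <;>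
  norm_num

theorem hadamard_conj_sigma : hadamard * sigma (0, 1) * hadamard = sigma (1, 0) := by
  have h2 : ((Real.sqrt 2 : ℂ)⁻¹) * ((Real.sqrt 2 : ℂ)⁻¹) = 1 / 2 := by
    rw [← mul_inv, ← Complex.ofReal_mul, Real.mul_self_sqrt (by norm_num)]
    norm_num
  ext u v
  rcases zmod_two_cases u with rfl | rfl <;> rcases zmod_two_cases v with rfl | rfl <;>
  simp [hadamard, sigma, Matrix.mul_apply, sum_zmod_two, val_zmod_two_one, div_eq_mul_inv, h2,
    add_self_zmod_two] <;>
  norm_num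

theorem localOp_update_mul (i : Fin n) (A B : Matrix (ZMod 2) (ZMod 2) ℂ) :
    localOp (Function.update (fun _ => 1) i A) * localOp (Function.update (fun _ => 1) i B) =
      localOp (Function.update (fun _ => 1) i (A * B)) := by
  rw [localOp_mul]
  congr 1
  ext1 j
  by_cases h : j = i
  · subst h; simp
  · simp [h]

theorem localOp_update_one (i : Fin n) :
    localOp (Function.update (fun _ : Fin n => (1 : Matrix (ZMod 2) (ZMod 2) ℂ)) i 1) = 1 := by
  rw [Function.update_eq_self_iff.mpr rfl, localOp_one]

theorem pauliMat_single_z (i : Fin n) :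
    pauliMat (Pi.single i (0, 1) : Pauli (Fin n)) =
      Matrix.diagonal fun w => (sgn (w i) : ℂ) := by
  rw [show (Pi.single i (0, 1) : Pauli (Fin n)) = zPauli (Pi.single i 1) by
    ext j <;> by_cases h : j = i <;> [subst h; skip; subst h; skip] <;> simp [zPauli, *],
    pauliMat_zPauli]
  simp

/-- The gate that measures a single stabilizer. -/
theorem ancillaH_mul_controlledPauli (i : Fin n) (S : Pauli (Fin m)) :
    ancillaH m i * controlledPauli i S * ancillaH m i = (1 / 2 : ℂ) •
      (1 + pauliMat (Sum.elim S 0 : Pauli (Reg m n)) +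
        pauliMat (Sum.elim 0 (Pi.single i (1, 0)) : Pauli (Reg m n)) -
        pauliMat (Sum.elim S 0 : Pauli (Reg m n)) *
          pauliMat (Sum.elim 0 (Pi.single i (1, 0)) : Pauli (Reg m n))) := by
  -- The control projectors are `(1 ± Z)/2`; the Hadamards turn `Z` into `X`.
  have h0 : (Matrix.diagonal fun w : Bits (Fin n) => if w i = 0 then (1 : ℂ) else 0) =
      (1 / 2 : ℂ) • (1 + pauliMat (Pi.single i (0, 1))) := by
    rw [pauliMat_single_z, ← Matrix.diagonal_one, Matrix.diagonal_add, ← Matrix.diagonal_smul]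
    congr 1; ext1 w
    rcases zmod_two_cases (w i) with h | h <;> simp [h, sgn_zero, sgn_one]; norm_num
  have h1 : (Matrix.diagonal fun w : Bits (Fin n) => if w i = 1 then (1 : ℂ) else 0) =
      (1 / 2 : ℂ) • (1 - pauliMat (Pi.single i (0, 1))) := by
    rw [pauliMat_single_z, ← Matrix.diagonal_one, Matrix.diagonal_sub, ← Matrix.diagonal_smul]
    congr 1; ext1 w
    rcases zmod_two_cases (w i) with h | h <;> simp [h, sgn_zero, sgn_one]; norm_num
  set H := localOp (Function.update (fun _ : Fin n => 1) i hadamard) with hH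
  have hHH : H * H = 1 := by rw [hH, localOp_update_mul, hadamard_mul_self, localOp_update_one]
  have hHZ : H * pauliMat (Pi.single i (0, 1)) * H = pauliMat (Pi.single i (1, 0)) := by
    rw [hH, pauliMat_single, pauliMat_single, localOp_update_mul, localOp_update_mul,
      hadamard_conj_sigma]
  have hone : (1 : QMat (Reg m n)) = tens 1 1 := by
    rw [← pauliMat_zero, ← pauliMat_zero, ← pauliMat_zero, ← pauliMat_sumElim]
    congr 1
    ext j <;> rcases j with j | j <;> rfl
  rw [ancillaH, ← hH, controlledPauli, h0, h1, mul_add, add_mul, tens_mul, tens_mul, tens_mul,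
    tens_mul, mul_smul_comm, smul_mul_assoc, mul_smul_comm, smul_mul_assoc, mul_add, mul_sub,
    add_mul, sub_mul, mul_one H, hHH, hHZ, pauliMat_sumElim, pauliMat_sumElim, pauliMat_zero,
    pauliMat_zero, tens_mul, hone, tens_smul, tens_smul, tens_add, tens_sub]
  simp only [one_mul, mul_one]
  module

theorem ancillaH_mul_controlledPauli_conjTranspose (i : Fin n) (S : Pauli (Fin m)) :
    (ancillaH m i * controlledPauli i S * ancillaH m i)ᴴ =
      ancillaH m i * controlledPauli i S * ancillaH m i := by
  rw [ancillaH_mul_controlledPauli, Matrix.conjTranspose_smul, Matrix.conjTranspose_sub,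
    Matrix.conjTranspose_mul, Matrix.conjTranspose_add, Matrix.conjTranspose_add,
    pauliMat_conjTranspose, pauliMat_conjTranspose, Matrix.conjTranspose_one,
    pauliMat_mul_comm (Sum.elim 0 _), symp_sumElim]
  simp [symp_zero_left, symp_comm _ (0 : Pauli _), sgn_zero]

/-- The gate is `S` controlled by the `X` of ancilla `i`, which anticommutes with `Z^x` exactly when
`x i = 1`. -/
theorem ancillaH_mul_controlledPauli_conj (i : Fin n) {S Q : Pauli (Fin m)} (hQ : symp Q S = 0)
    (x : Bits (Fin n)) :
    ∃ c : ℂ, c ≠ 0 ∧ (ancillaH m i * controlledPauli i S * ancillaH m i) *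
      pauliMat (Sum.elim Q (zPauli x)) * (ancillaH m i * controlledPauli i S * ancillaH m i) =
      c • pauliMat (Sum.elim (Q + if x i = 1 then S else 0) (zPauli x) : Pauli (Reg m n)) := by
  set A := pauliMat (Sum.elim S 0 : Pauli (Reg m n)) with hA
  set B := pauliMat (Sum.elim 0 (Pi.single i (1, 0)) : Pauli (Reg m n)) with hB
  set W := pauliMat (Sum.elim Q (zPauli x) : Pauli (Reg m n)) with hW
  have hAB : B * A = A * B := by
    rw [hA, hB, pauliMat_mul_comm, symp_sumElim]
    simp [symp_zero_left, symp_comm _ (0 : Pauli _), sgn_zero]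
  have hAW : A * W = W * A := by
    rw [hA, hW, pauliMat_mul_comm, symp_sumElim, symp_comm S, hQ]
    simp [symp_zero_left, sgn_zero]
  have hs : symp (Pi.single i (1, 0)) (zPauli x) = x i := by
    rw [symp, Finset.sum_eq_single i]
    · simp [zPauli]
    · intro j _ hj
      simp [Pi.single_eq_of_ne hj]
    · simp
  have hBW : B * W = (sgn (x i) : ℂ) • (W * B) := by
    rw [hB, hW, pauliMat_mul_comm, symp_sumElim, hs, symp_zero_left, zero_add]
  rw [ancillaH_mul_controlledPauli, ← hA, ← hB, smul_mul_assoc, smul_mul_assoc, mul_smul_comm,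
    smul_smul]
  rcases zmod_two_cases (x i) with hx | hx
  · rw [hx, sgn_zero, Complex.ofReal_one, one_smul] at hBW
    refine ⟨1, one_ne_zero, ?_⟩
    rw [conj_eq_self_of_commute (pauliMat_mul_self _) (pauliMat_mul_self _) hAB hAW hBW, hx,
      if_neg (by decide), add_zero, ← hW, show (4 : QMat (Reg m n)) = (4 : ℂ) • 1 by
        rw [← Algebra.algebraMap_eq_smul_one, map_ofNat], smul_mul_assoc, one_mul, smul_smul]
    norm_num
  · rw [hx, sgn_one, Complex.ofReal_neg, Complex.ofReal_one, neg_one_smul] at hBW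
    obtain ⟨c, hc, h⟩ := pauliMat_mul (Sum.elim Q (zPauli x) : Pauli (Reg m n)) (Sum.elim S 0)
    refine ⟨c, hc, ?_⟩
    rw [conj_eq_mul_of_anticommute (pauliMat_mul_self _) (pauliMat_mul_self _) hAB hAW hBW, hx,
      if_pos rfl, hW, hA, h, ← Sum.elim_add_add, add_zero, show (4 : QMat (Reg m n)) = (4 : ℂ) • 1 by
        rw [← Algebra.algebraMap_eq_smul_one, map_ofNat], smul_mul_assoc, one_mul, smul_smul]
    norm_num

theorem syndromeGate_conj {S : Fin n → Pauli (Fin m)} (hS : ∀ i j, symp (S i) (S j) = 0)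
    {Q : Pauli (Fin m)} (hQ : Q ∈ centralizer S) (x : Bits (Fin n)) :
    ∃ c : ℂ, c ≠ 0 ∧ (syndromeGate S)ᴴ * pauliMat (Sum.elim Q (zPauli x)) * syndromeGate S =
      c • pauliMat (Sum.elim (Q + stabPow S x) (zPauli x) : Pauli (Reg m n)) := by
  set g : Fin n → QMat (Reg m n) := fun i => ancillaH m i * controlledPauli i (S i) * ancillaH m i
    with hg
  -- Membership in the centralizer is carried through the induction: each gate requires the current
  -- data Pauli to commute with its stabilizer, and pairwise commutation preserves this.
  have key : ∀ l : List (Fin n), ∃ c : ℂ, c ≠ 0 ∧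
      ((l.map g).reverse.prod)ᴴ * pauliMat (Sum.elim Q (zPauli x)) * (l.map g).reverse.prod =
      c • pauliMat (Sum.elim (Q + (l.map fun i => if x i = 1 then S i else 0).sum)
        (zPauli x) : Pauli (Reg m n)) ∧
      (Q + (l.map fun i => if x i = 1 then S i else 0).sum) ∈ centralizer S := by
    intro l
    induction l with
    | nil => exact ⟨1, one_ne_zero, by simp, by simpa using hQ⟩
    | cons i l ih =>
      obtain ⟨c, hc, h, hl⟩ := ih
      obtain ⟨c', hc', h'⟩ := ancillaH_mul_controlledPauli_conj i (hl i) x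
      refine ⟨c * c', mul_ne_zero hc hc', ?_, fun j => ?_⟩
      · rw [List.map_cons, List.reverse_cons, List.prod_append, List.prod_singleton,
          Matrix.conjTranspose_mul,
          show ∀ a b c d e : QMat (Reg m n), a * b * c * (d * e) = a * (b * c * d) * e by
            intros; simp only [mul_assoc], h, hg, ancillaH_mul_controlledPauli_conjTranspose,
          mul_smul_comm, smul_mul_assoc, h', smul_smul, List.map_cons, List.sum_cons,
          add_comm (if x i = 1 then S i else 0), add_assoc]
      · rw [List.map_cons, List.sum_cons, add_left_comm, symp_add_left, hl j, add_zero]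
        split_ifs
        · exact hS i j
        · exact symp_zero_left _
  obtain ⟨c, hc, h, -⟩ := key (List.finRange n)
  refine ⟨c, hc, ?_⟩
  rw [syndromeGate, List.ofFn_eq_map, h, stabPow, ← List.sum_ofFn, List.ofFn_eq_map]

end SyndromeGate

/-! ### What Pauli experiments determine. -/

section PauliExperiments

variable {m n : ℕ} {ι : Type*}

theorem posSemidef_half_of_reflection {q : Type} [Fintype q] [DecidableEq q] {W : QMat q}
    (hW : Wᴴ = W) (hWW : W * W = 1) : ((1 / 2 : ℂ) • (1 + W)).PosSemidef := by
  have h : (1 / 2 : ℂ) • (1 + W) = ((1 / 2 : ℂ) • (1 + W))ᴴ * ((1 / 2 : ℂ) • (1 + W)) := by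
    rw [Matrix.conjTranspose_smul, Matrix.conjTranspose_add, hW, Matrix.conjTranspose_one,
      smul_mul_smul_comm, add_mul, mul_add, mul_add, hWW]
    simp only [mul_one, one_mul, Complex.star_def, map_div₀, map_one, map_ofNat]
    module
  rw [h]
  exact Matrix.posSemidef_conjTranspose_mul_self _

/-- The experiment that ends with the measurement of a Pauli operator. -/
noncomputable def pauliExperiment (d : ℕ) (C : Fin (d + 1) → List (Gate m n ι)) (T : Pauli (Reg m n)) :
    Experiment m n ι where
  numMCM := d
  gates := C
  numOutcomes := 2
  effect := ![(1 / 2 : ℂ) • (1 + pauliMat T), (1 / 2 : ℂ) • (1 + -pauliMat T)]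
  effect_posSemidef := by
    rw [Fin.forall_fin_two]
    exact ⟨posSemidef_half_of_reflection (pauliMat_conjTranspose T) (pauliMat_mul_self T),
      posSemidef_half_of_reflection (by rw [Matrix.conjTranspose_neg, pauliMat_conjTranspose])
        (by rw [neg_mul_neg, pauliMat_mul_self])⟩
  sum_effect := by
    simp only [Fin.sum_univ_two, Matrix.cons_val_zero, Matrix.cons_val_one]
    module

variable {U : ι → QMat (Reg m n)} {G : QMat (Reg m n)} {N₁ N₂ : NoiseModel m n ι}

/-- The two effects differ by the Pauli matrix of `T`, an eigenoperator of the measurement noise. -/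
theorem prob_pauliExperiment (N : NoiseModel m n ι) (d : ℕ) (C : Fin (d + 1) → List (Gate m n ι))
    (T : Pauli (Reg m n)) (k : Fin d → Bits (Fin n)) :
    N.prob U G (pauliExperiment d C T) k (0 : Fin 2) -
        N.prob U G (pauliExperiment d C T) k (1 : Fin 2) =
      N.measNoise.fidelity T * (pauliMat T * N.run U G d C k N.state).trace.re := by
  rw [← Complex.re_ofReal_mul, ← PauliNoise.trace_pauliMat_mul_apply]
  simp only [NoiseModel.prob, pauliExperiment, Matrix.cons_val_zero, Matrix.cons_val_one]
  rw [← Complex.sub_re, ← Matrix.trace_sub, ← sub_mul]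
  congr 3
  module

theorem Indistinguishable.fidelity_mul_trace_run (h : Indistinguishable U G N₁ N₂) (d : ℕ)
    (C : Fin (d + 1) → List (Gate m n ι)) (T : Pauli (Reg m n)) (k : Fin d → Bits (Fin n)) :
    N₁.measNoise.fidelity T * (pauliMat T * N₁.run U G d C k N₁.state).trace.re =
      N₂.measNoise.fidelity T * (pauliMat T * N₂.run U G d C k N₂.state).trace.re := by
  rw [← prob_pauliExperiment, ← prob_pauliExperiment,
    h (pauliExperiment d C T) k (0 : Fin 2), h (pauliExperiment d C T) k (1 : Fin 2)]

theorem Indistinguishable.fidelity_mul_trace_state (h : Indistinguishable U G N₁ N₂)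
    (T : Pauli (Reg m n)) :
    N₁.measNoise.fidelity T * (pauliMat T * N₁.state).trace.re =
      N₂.measNoise.fidelity T * (pauliMat T * N₂.state).trace.re :=
  h.fidelity_mul_trace_run 0 (fun _ => []) T Fin.elim0

/-- A layer of single-qubit gates, a mid-circuit measurement and a Pauli measurement determine a
Pauli fidelity of the mid-circuit measurement up to state preparation and measurement. -/
theorem Indistinguishable.fidelity_mul_mcm_fidelity (h : Indistinguishable U G N₁ N₂)
    (V : Reg m n → Matrix.unitaryGroup (ZMod 2) ℂ) (x y : Bits (Fin n)) (Q : Pauli (Fin m)) :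
    N₁.measNoise.fidelity (Sum.elim Q (zPauli y)) * (N₁.mcm.fidelity x y Q *
        (Gᴴ * pauliMat (Sum.elim Q (zPauli x)) * G * (localOp (fun j => (V j).1) * N₁.state *
          (localOp fun j => (V j).1)ᴴ)).trace.re) =
      N₂.measNoise.fidelity (Sum.elim Q (zPauli y)) * (N₂.mcm.fidelity x y Q *
        (Gᴴ * pauliMat (Sum.elim Q (zPauli x)) * G * (localOp (fun j => (V j).1) * N₂.state *
          (localOp fun j => (V j).1)ᴴ)).trace.re) := by
  have hN : ∀ N : NoiseModel m n ι, N.mcm.fidelity x y Q *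
        (Gᴴ * pauliMat (Sum.elim Q (zPauli x)) * G * (localOp (fun j => (V j).1) * N.state *
          (localOp fun j => (V j).1)ᴴ)).trace.re = ∑ k : Bits (Fin n), sgn (k ⬝ᵥ (x + y)) *
        (pauliMat (Sum.elim Q (zPauli y)) * N.run U G 1 ![[Gate.single V], []] (fun _ => k)
          N.state).trace.re := fun N => by
    rw [← Complex.re_ofReal_mul, ← MCMNoise.sum_sgn_mul_trace_apply, Complex.re_sum]
    refine Finset.sum_congr rfl fun k _ => ?_
    rw [Complex.re_ofReal_mul]
    rfl
  rw [hN, hN, Finset.mul_sum, Finset.mul_sum]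
  refine Finset.sum_congr rfl fun k _ => ?_
  rw [mul_left_comm, h.fidelity_mul_trace_run, mul_left_comm]

/-- For indistinguishable noise models, the ratio of the Pauli fidelities of the mid-circuit
measurement is a coboundary. -/
theorem Indistinguishable.log_fidelity_sub {S : Fin n → Pauli (Fin m)}
    (hS : ∀ i j, symp (S i) (S j) = 0) (h : Indistinguishable U (syndromeGate S) N₁ N₂)
    (x y : Bits (Fin n)) {Q : Pauli (Fin m)} (hQ : Q ∈ centralizer S) :
    Real.log (N₁.mcm.fidelity x y Q) - Real.log (N₂.mcm.fidelity x y Q) =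
      (Real.log (N₁.measNoise.fidelity (Sum.elim (Q + stabPow S x) (zPauli x))) -
        Real.log (N₂.measNoise.fidelity (Sum.elim (Q + stabPow S x) (zPauli x)))) -
      (Real.log (N₁.measNoise.fidelity (Sum.elim Q (zPauli y))) -
        Real.log (N₂.measNoise.fidelity (Sum.elim Q (zPauli y)))) := by
  set T : Pauli (Reg m n) := Sum.elim (Q + stabPow S x) (zPauli x) with hT
  set G := syndromeGate S with hG
  -- The state need not overlap with `T` itself; a Pauli `R` of the same pattern does, and noiseless
  -- local gates rotate between the two.
  obtain ⟨R, hR, hR0⟩ := N₁.state_overlap (pt T)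
  obtain ⟨V, hV⟩ := exists_localOp_pauliMat hR
  obtain ⟨c, hc, hconj⟩ := syndromeGate_conj hS hQ x
  have hst : ∀ N : NoiseModel m n ι, N.stateᴴ = N.state := fun N => N.state_posSemidef.1
  set L : QMat (Reg m n) := localOp fun j => (V j).1 with hL
  have hz : ∀ N : NoiseModel m n ι,
      (Gᴴ * pauliMat (Sum.elim Q (zPauli x)) * G * (L * N.state * Lᴴ)).trace =
        c * (pauliMat R * N.state).trace := fun N => by
    rw [hconj, smul_mul_assoc, Matrix.trace_smul, smul_eq_mul, ← hV, ← mul_assoc,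
      Matrix.trace_mul_comm]
    simp only [mul_assoc, hT]
  have ht : ∀ N : NoiseModel m n ι, (((pauliMat R * N.state).trace.re : ℝ) : ℂ) =
      (pauliMat R * N.state).trace := fun N =>
    trace_mul_re_of_isHermitian (pauliMat_conjTranspose R) (hst N)
  have hzr : ∀ N : NoiseModel m n ι,
      (((Gᴴ * pauliMat (Sum.elim Q (zPauli x)) * G * (L * N.state * Lᴴ)).trace.re : ℝ) : ℂ) =
        c * ((pauliMat R * N.state).trace.re : ℝ) := fun N => by
    rw [ht, ← hz]
    refine trace_mul_re_of_isHermitian ?_ ?_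
    · simp [Matrix.conjTranspose_mul, pauliMat_conjTranspose, mul_assoc]
    · simp [Matrix.conjTranspose_mul, hst, mul_assoc]
  have e0 := h.fidelity_mul_trace_state R
  have e1 := h.fidelity_mul_mcm_fidelity V x y Q
  set t₁ := (pauliMat R * N₁.state).trace.re
  set t₂ := (pauliMat R * N₂.state).trace.re
  have ht₁ : t₁ ≠ 0 := fun h0 => hR0 (by rw [← ht N₁]; exact_mod_cast h0)
  -- The phase `c` depends on the circuit alone, hence is common to both models and cancels.
  have e1' : N₁.measNoise.fidelity (Sum.elim Q (zPauli y)) * (N₁.mcm.fidelity x y Q * t₁) =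
      N₂.measNoise.fidelity (Sum.elim Q (zPauli y)) * (N₂.mcm.fidelity x y Q * t₂) := by
    have e2 := congrArg (fun r : ℝ => (r : ℂ)) e1
    simp only [Complex.ofReal_mul, ← hL, hzr] at e2
    rw [← Complex.ofReal_inj]
    refine mul_left_cancel₀ hc ?_
    push_cast
    linear_combination e2
  -- Symmetry of the measurement noise replaces its fidelity at `R` by that at `T`.
  rw [N₁.measNoise_symm R T hR, N₂.measNoise_symm R T hR] at e0
  have p₁ : 0 < N₁.measNoise.fidelity T := N₁.measNoise.fidelity_pos T
  have p₂ : 0 < N₂.measNoise.fidelity T := N₂.measNoise.fidelity_pos T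
  have q₁ : 0 < N₁.measNoise.fidelity (Sum.elim Q (zPauli y)) := N₁.measNoise.fidelity_pos _
  have q₂ : 0 < N₂.measNoise.fidelity (Sum.elim Q (zPauli y)) := N₂.measNoise.fidelity_pos _
  have l₁ : 0 < N₁.mcm.fidelity x y Q := N₁.mcm.fidelity_pos x y Q
  have l₂ : 0 < N₂.mcm.fidelity x y Q := N₂.mcm.fidelity_pos x y Q
  -- `e0` eliminates `t₂`, after which the non-zero `t₁` cancels.
  have e4 : N₁.measNoise.fidelity (Sum.elim Q (zPauli y)) * N₁.mcm.fidelity x y Q *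
      N₂.measNoise.fidelity T = N₂.measNoise.fidelity (Sum.elim Q (zPauli y)) *
        N₂.mcm.fidelity x y Q * N₁.measNoise.fidelity T := by
    refine mul_right_cancel₀ ht₁ ?_
    linear_combination N₂.measNoise.fidelity T * e1' -
      N₂.measNoise.fidelity (Sum.elim Q (zPauli y)) * N₂.mcm.fidelity x y Q * e0
  have e5 := congrArg Real.log e4
  rw [Real.log_mul (by positivity) p₂.ne', Real.log_mul q₁.ne' l₁.ne',
    Real.log_mul (by positivity) p₁.ne', Real.log_mul q₂.ne' l₂.ne'] at e5
  linarith

end PauliExperiments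

/-! ### Stabilizer averages and cancellation of the coboundary. -/

section Averages

variable {m n : ℕ}

theorem symp_stabPow_left (S : Fin n → Pauli (Fin m)) (k : Bits (Fin n)) (Q : Pauli (Fin m)) :
    symp (stabPow S k) Q = (fun i => symp Q (S i)) ⬝ᵥ k := by
  rw [symp_comm, stabPow, symp_sum_right, dotProduct]
  refine Finset.sum_congr rfl fun i _ => ?_
  rcases zmod_two_cases (k i) with h | h
  · rw [h, if_neg (by decide), symp_comm, symp_zero_left, mul_zero]
  · rw [h, if_pos rfl, mul_one]

theorem symp_stabPow_right {S : Fin n → Pauli (Fin m)} {Q : Pauli (Fin m)}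
    (hQ : Q ∈ centralizer S) (k : Bits (Fin n)) : symp Q (stabPow S k) = 0 := by
  rw [symp_comm, symp_stabPow_left, show (fun i => symp Q (S i)) = 0 from funext hQ,
    zero_dotProduct]

theorem stabPow_mem_centralizer {S : Fin n → Pauli (Fin m)} (hS : ∀ i j, symp (S i) (S j) = 0)
    (k : Bits (Fin n)) : stabPow S k ∈ centralizer S := fun i => by
  rw [symp_comm, symp_stabPow_right (fun j => hS i j)]

/-- Averaging over the stabilizer group projects onto the centralizer. -/
theorem sum_sgn_symp_stabPow {S : Fin n → Pauli (Fin m)} {Q : Pauli (Fin m)}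
    (hQ : Q ∉ centralizer S) : ∑ k, sgn (symp (stabPow S k) Q) = 0 := by
  simp only [symp_stabPow_left]
  exact sum_sgn_dotProduct fun h => hQ fun i => congrFun h i

theorem sum_coboundary_eq_zero {S : Fin n → Pauli (Fin m)} (hS : ∀ i j, symp (S i) (S j) = 0)
    {P : Pauli (Fin m)} (hP : P ∈ centralizer S) (a : Bits (Fin n))
    (f : Pauli (Fin m) → Bits (Fin n) → ℝ) :
    ∑ x, ∑ y, ∑ Q, (∑ k, sgn (symp (stabPow S k) Q)) * sgn (symp P Q) *
      (sgn (a ⬝ᵥ y) + sgn (a ⬝ᵥ x)) * (f (Q + stabPow S x) x - f Q y) = 0 := by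
  set w : Pauli (Fin m) → ℝ := fun Q => (∑ k, sgn (symp (stabPow S k) Q)) * sgn (symp P Q)
    with hw
  -- `P` and all `S^k` commute with `S^x`, so the weight is constant along the shift.
  have hshift : ∀ x Q, w (Q + stabPow S x) = w Q := fun x Q => by
    simp only [hw, symp_add_right, symp_stabPow_right hP,
      symp_stabPow_right (stabPow_mem_centralizer hS _), add_zero]
  set F : Bits (Fin n) → ℝ := fun x => ∑ Q, w Q * f Q x with hF
  have hinner : ∀ x y, ∑ Q, w Q * (sgn (a ⬝ᵥ y) + sgn (a ⬝ᵥ x)) *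
      (f (Q + stabPow S x) x - f Q y) = (sgn (a ⬝ᵥ y) + sgn (a ⬝ᵥ x)) * (F x - F y) :=
    fun x y => by
      have h1 : F x = ∑ Q, w Q * f (Q + stabPow S x) x := by
        refine (Equiv.sum_comp (Equiv.addRight (stabPow S x)) fun Q => w Q * f Q x).symm.trans ?_
        simp only [Equiv.coe_addRight, hshift]
      rw [h1, hF, ← Finset.sum_sub_distrib, Finset.mul_sum]
      refine Finset.sum_congr rfl fun Q _ => ?_
      ring
  change ∑ x, ∑ y, ∑ Q, w Q * (sgn (a ⬝ᵥ y) + sgn (a ⬝ᵥ x)) *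
      (f (Q + stabPow S x) x - f Q y) = 0
  simp only [hinner]
  -- Exchanging `x` and `y` fixes the sign weight and negates `F x - F y`.
  have hanti : ∑ x, ∑ y, (sgn (a ⬝ᵥ y) + sgn (a ⬝ᵥ x)) * (F x - F y) =
      -∑ x, ∑ y, (sgn (a ⬝ᵥ y) + sgn (a ⬝ᵥ x)) * (F x - F y) := by
    conv_lhs => rw [Finset.sum_comm]
    simp only [← Finset.sum_neg_distrib]
    refine Finset.sum_congr rfl fun x _ => Finset.sum_congr rfl fun y _ => ?_
    ring
  linarith

/-- The term `sgn (a ⬝ᵥ y)` comes from `p_{0,a}` and `sgn (a ⬝ᵥ x)` from `p_{a,0}`; both are needed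
for a weight symmetric in `x, y`. -/
theorem sum_rateApprox (M : MCMNoise m n) (S : Fin n → Pauli (Fin m)) (P : Pauli (Fin m))
    (a : Bits (Fin n)) :
    ∑ k, (M.rateApprox 0 a (stabPow S k + P) + M.rateApprox a 0 (stabPow S k + P)) =
      1 / 4 ^ (n + m) * ∑ x, ∑ y, ∑ Q, (∑ k, sgn (symp (stabPow S k) Q)) * sgn (symp P Q) *
        (sgn (a ⬝ᵥ y) + sgn (a ⬝ᵥ x)) * (1 + Real.log (M.fidelity x y Q)) := by
  simp only [MCMNoise.rateApprox, ← mul_add, ← Finset.mul_sum, ← Finset.sum_add_distrib]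
  congr 1
  rw [Finset.sum_comm]
  refine Finset.sum_congr rfl fun x _ => ?_
  rw [Finset.sum_comm]
  refine Finset.sum_congr rfl fun y _ => ?_
  rw [Finset.sum_comm]
  refine Finset.sum_congr rfl fun Q _ => ?_
  simp only [Finset.sum_mul]
  refine Finset.sum_congr rfl fun k _ => ?_
  simp only [zero_dotProduct, symp_add_left, sgn_add, sgn_zero]
  ring

theorem learnable_sum_rateApprox {ι : Type*} (U : ι → QMat (Reg m n)) {S : Fin n → Pauli (Fin m)}
    (hS : ∀ i j, symp (S i) (S j) = 0) {P : Pauli (Fin m)} (hP : P ∈ centralizer S)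
    (a : Bits (Fin n)) :
    Learnable U (syndromeGate S) (fun N => ∑ k, (N.mcm.rateApprox 0 a (stabPow S k + P) +
      N.mcm.rateApprox a 0 (stabPow S k + P))) := by
  intro N₁ N₂ h
  simp only [sum_rateApprox]
  refine congrArg (1 / 4 ^ (n + m) * ·) (sub_eq_zero.mp (Eq.trans ?_
    (sum_coboundary_eq_zero hS hP a fun Q y =>
      Real.log (N₁.measNoise.fidelity (Sum.elim Q (zPauli y))) -
        Real.log (N₂.measNoise.fidelity (Sum.elim Q (zPauli y))))))
  simp only [← Finset.sum_sub_distrib]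
  refine Finset.sum_congr rfl fun x _ => Finset.sum_congr rfl fun y _ =>
    Finset.sum_congr rfl fun Q _ => ?_
  -- Outside the centralizer the stabilizer average is zero, so nothing about those fidelities is
  -- required.
  by_cases hQ : Q ∈ centralizer S
  · rw [← h.log_fidelity_sub hS x y hQ]
    ring
  · rw [sum_sgn_symp_stabPow hQ]
    ring

end Averages

/-! ### Error of the first-order approximation. -/

section FirstOrder

variable {m n : ℕ}

/-- With `t = 1 - x` this amounts to `1 ≤ (1 - x) exp (x + x^2)`, for which the quadratic Taylor
bound of `exp` suffices when `x ≤ 1/2`. -/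
theorem abs_sub_one_sub_log_le {t : ℝ} (h1 : 1 / 2 ≤ t) (h2 : t ≤ 1) :
    |t - 1 - Real.log t| ≤ (1 - t) ^ 2 := by
  have hlog := Real.log_le_sub_one_of_pos (by linarith : 0 < t)
  rw [abs_of_nonneg (by linarith)]
  obtain ⟨x, rfl⟩ : ∃ x, t = 1 - x := ⟨1 - t, by ring⟩
  have hx0 : 0 ≤ x := by linarith
  have hx : x ≤ 1 / 2 := by linarith
  have hexp := Real.quadratic_le_exp_of_nonneg (show 0 ≤ x + x ^ 2 by positivity)
  have hkey : 1 ≤ (1 - x) * Real.exp (x + x ^ 2) := by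
    refine le_trans ?_ (mul_le_mul_of_nonneg_left hexp (by linarith))
    have h2' : x ^ 2 ≤ 1 / 4 := by nlinarith
    have h3' : x ^ 3 ≤ 1 / 8 := by nlinarith
    have h3 : 0 ≤ x ^ 2 * (1 - x - x ^ 2 - x ^ 3) := mul_nonneg (sq_nonneg x) (by linarith)
    have h4 : (1 - x) * (1 + (x + x ^ 2) + (x + x ^ 2) ^ 2 / 2) =
        1 + x ^ 2 * (1 - x - x ^ 2 - x ^ 3) / 2 := by ring
    linarith
  have h4 : -(x + x ^ 2) ≤ Real.log (1 - x) := by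
    rw [Real.le_log_iff_exp_le (by linarith), Real.exp_neg]
    exact (inv_le_iff_one_le_mul₀ (Real.exp_pos _)).mpr hkey
  nlinarith

theorem sum_sgn_mcm (a b : Bits (Fin n)) (P : Pauli (Fin m)) (h : ¬(a = 0 ∧ b = 0 ∧ P = 0)) :
    ∑ x, ∑ y, ∑ Q, sgn (a ⬝ᵥ x + b ⬝ᵥ y + symp P Q) = 0 := by
  simp only [sgn_add, ← Finset.mul_sum, ← Finset.sum_mul]
  by_cases ha : a = 0
  · by_cases hb : b = 0
    · rw [sum_sgn_symp fun hP => h ⟨ha, hb, hP⟩, mul_zero]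
    · rw [sum_sgn_dotProduct hb, mul_zero, zero_mul]
  · rw [sum_sgn_dotProduct ha, zero_mul, zero_mul]

/-- Fourier inversion: by orthogonality of characters only the rate at `(a, b, P)` survives. -/
theorem MCMNoise.rate_eq (M : MCMNoise m n) (a b : Bits (Fin n)) (P : Pauli (Fin m)) :
    M.rate a b P = 1 / 4 ^ (n + m) * ∑ x, ∑ y, ∑ Q,
      sgn (a ⬝ᵥ x + b ⬝ᵥ y + symp P Q) * M.fidelity x y Q := by
  have hself : ∀ {V : Type} [AddCommGroup V], (∀ v : V, v + v = 0) → ∀ u v : V, u + v = 0 ↔ v = u :=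
    fun h2 u v => by rw [← h2 u, add_right_inj]
  have hB : ∀ v : Bits (Fin n), v + v = 0 := fun v => by ext j; simp [add_self_zmod_two]
  have hPl : ∀ v : Pauli (Fin m), v + v = 0 := fun v => by
    ext j <;> simp [add_self_zmod_two]
  have hcomm : ∑ x, ∑ y, ∑ Q, sgn (a ⬝ᵥ x + b ⬝ᵥ y + symp P Q) * M.fidelity x y Q =
      ∑ v : Bits (Fin n) × Bits (Fin n) × Pauli (Fin m), M.rate v.1 v.2.1 v.2.2 *
        ∑ x, ∑ y, ∑ Q, sgn ((a + v.1) ⬝ᵥ x + (b + v.2.1) ⬝ᵥ y + symp (P + v.2.2) Q) := by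
    have hf : ∀ x y Q, M.fidelity x y Q = ∑ v : Bits (Fin n) × Bits (Fin n) × Pauli (Fin m),
        sgn (v.1 ⬝ᵥ x + v.2.1 ⬝ᵥ y + symp v.2.2 Q) * M.rate v.1 v.2.1 v.2.2 := fun x y Q => by
      simp only [MCMNoise.fidelity, Fintype.sum_prod_type]
    simp only [hf, Finset.mul_sum]
    symm
    rw [Finset.sum_comm]
    refine Finset.sum_congr rfl fun x _ => ?_
    rw [Finset.sum_comm]
    refine Finset.sum_congr rfl fun y _ => ?_
    rw [Finset.sum_comm]
    refine Finset.sum_congr rfl fun Q _ => Finset.sum_congr rfl fun v _ => ?_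
    simp only [add_dotProduct, symp_add_left, sgn_add]
    ring
  rw [hcomm, Finset.sum_eq_single (a, b, P)]
  · simp only [hB, hPl, zero_dotProduct, symp_zero_left, add_zero, sgn_zero, Finset.sum_const,
      Finset.card_univ, nsmul_eq_mul, mul_one, Fintype.card_fun, Fintype.card_prod, ZMod.card,
      Fintype.card_fin]
    push_cast
    rw [show (4 : ℝ) ^ (n + m) = 2 ^ n * (2 ^ n * 4 ^ m) by
      rw [pow_add, ← mul_assoc, ← mul_pow]; norm_num]
    field_simp
  · rintro ⟨a', b', P'⟩ - hne
    rw [sum_sgn_mcm, mul_zero]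
    rw [hself hB, hself hB, hself hPl]
    rintro ⟨rfl, rfl, rfl⟩
    exact hne rfl
  · simp

theorem MCMNoise.fidelity_le_one (M : MCMNoise m n) (x y : Bits (Fin n)) (Q : Pauli (Fin m)) :
    M.fidelity x y Q ≤ 1 := by
  rw [← M.sum_rate, MCMNoise.fidelity]
  refine Finset.sum_le_sum fun a _ => Finset.sum_le_sum fun b _ => Finset.sum_le_sum fun P _ => ?_
  exact mul_le_of_le_one_left (M.rate_pos a b P).le ((le_abs_self _).trans (abs_sgn _).le)

theorem MCMNoise.le_fidelity (M : MCMNoise m n) (x y : Bits (Fin n)) (Q : Pauli (Fin m)) :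
    1 - 2 * (1 - M.rate 0 0 0) ≤ M.fidelity x y Q := by
  have hsum := M.sum_rate
  -- `λ + 1` is a sum of non-negative terms `(sgn + 1) p`, and the error-free term alone contributes
  -- `2 p^I_{0,0}`.
  have h : 2 * M.rate 0 0 0 ≤ M.fidelity x y Q + 1 := by
    rw [← hsum, MCMNoise.fidelity]
    simp only [← Fintype.sum_prod_type', ← Finset.sum_add_distrib]
    refine le_trans (le_of_eq ?_) (Finset.single_le_sum (f := fun v : Bits (Fin n) ×
      Bits (Fin n) × Pauli (Fin m) => sgn (v.1 ⬝ᵥ x + v.2.1 ⬝ᵥ y + symp v.2.2 Q) *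
        M.rate v.1 v.2.1 v.2.2 + M.rate v.1 v.2.1 v.2.2) (fun v _ => ?_)
      (Finset.mem_univ (0, 0, 0)))
    · simp only [zero_dotProduct, symp_zero_left, add_zero, sgn_zero]
      ring
    · have h1 := (abs_le.mp (abs_sgn (v.1 ⬝ᵥ x + v.2.1 ⬝ᵥ y + symp v.2.2 Q)).le).1
      nlinarith [M.rate_pos v.1 v.2.1 v.2.2]
  linarith

theorem MCMNoise.abs_rate_sub_rateApprox_le (M : MCMNoise m n) (hM : 1 - M.rate 0 0 0 ≤ 1 / 4)
    (a b : Bits (Fin n)) (P : Pauli (Fin m)) :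
    |M.rate a b P - M.rateApprox a b P| ≤ 4 * (1 - M.rate 0 0 0) ^ 2 := by
  have hterm : ∀ x y Q, |M.fidelity x y Q - 1 - Real.log (M.fidelity x y Q)| ≤
      4 * (1 - M.rate 0 0 0) ^ 2 := fun x y Q => by
    have h1 := M.fidelity_le_one x y Q
    have h2 := M.le_fidelity x y Q
    -- `ε ≤ 1/4` gives `λ ≥ 1 - 2ε ≥ 1/2`, and `(1 - λ)^2 ≤ (2ε)^2`.
    refine (abs_sub_one_sub_log_le (by linarith) h1).trans ?_
    nlinarith
  rw [M.rate_eq, MCMNoise.rateApprox, ← mul_sub]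
  simp only [← Finset.sum_sub_distrib, ← mul_sub]
  rw [abs_mul, abs_of_pos (by positivity), one_div, inv_mul_le_iff₀ (by positivity)]
  simp only [← Fintype.sum_prod_type']
  refine (Finset.abs_sum_le_sum_abs _ _).trans ((Finset.sum_le_card_nsmul _ _
    (4 * (1 - M.rate 0 0 0) ^ 2) fun v _ => ?_).trans (le_of_eq ?_))
  · rw [abs_mul, abs_sgn, one_mul, ← sub_sub]
    exact hterm _ _ _
  · simp only [Finset.card_univ, nsmul_eq_mul, Fintype.card_fun, Fintype.card_prod, ZMod.card,
      Fintype.card_fin]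
    push_cast
    rw [show (4 : ℝ) ^ (n + m) = 2 ^ n * (2 ^ n * 4 ^ m) by
      rw [pow_add, ← mul_assoc, ← mul_pow]; norm_num]

theorem MCMNoise.abs_sum_rate_sub_le (M : MCMNoise m n) (hM : 1 - M.rate 0 0 0 ≤ 1 / 4)
    (S : Fin n → Pauli (Fin m)) (P : Pauli (Fin m)) (a : Bits (Fin n)) :
    |∑ k, (M.rate 0 a (stabPow S k + P) + M.rate a 0 (stabPow S k + P)) -
        ∑ k, (M.rateApprox 0 a (stabPow S k + P) + M.rateApprox a 0 (stabPow S k + P))| ≤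
      2 ^ (n + 3) * (1 - M.rate 0 0 0) ^ 2 := by
  rw [← Finset.sum_sub_distrib]
  -- Two rates with error `4ε^2` each, for each of the `2^n` strings `k`.
  refine (Finset.abs_sum_le_sum_abs _ _).trans ((Finset.sum_le_card_nsmul _ _
    (8 * (1 - M.rate 0 0 0) ^ 2) fun k _ => ?_).trans (le_of_eq ?_))
  · rw [add_sub_add_comm]
    refine (abs_add_le _ _).trans ?_
    linarith [M.abs_rate_sub_rateApprox_le hM 0 a (stabPow S k + P),
      M.abs_rate_sub_rateApprox_le hM a 0 (stabPow S k + P)]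
  · simp only [Finset.card_univ, nsmul_eq_mul, Fintype.card_fun, ZMod.card, Fintype.card_fin]
    push_cast
    ring

end FirstOrder

end MCM

theorem proposition3 (m n : ℕ) {ι : Type*}
    (U : ι → QMat (Reg m n)) (hU : ∀ i, IsClifford (U i))
    (S : Fin n → Pauli (Fin m)) (hS : ∀ i j, symp (S i) (S j) = 0)
    (P : Pauli (Fin m)) (hP : P ∈ centralizer S)
    (a : Bits (Fin n)) (ha : a ≠ 0) :
    Learnable U (syndromeGate S)
        (fun N => ∑ k, (N.mcm.rateApprox 0 a (stabPow S k + P) +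
          N.mcm.rateApprox a 0 (stabPow S k + P))) ∧
      ∀ N : NoiseModel m n ι, 1 - N.mcm.rate 0 0 0 ≤ 1 / 4 →
        |∑ k, (N.mcm.rate 0 a (stabPow S k + P) + N.mcm.rate a 0 (stabPow S k + P)) -
            ∑ k, (N.mcm.rateApprox 0 a (stabPow S k + P) +
              N.mcm.rateApprox a 0 (stabPow S k + P))| ≤
          2 ^ (n + 3) * (1 - N.mcm.rate 0 0 0) ^ 2 :=
  ⟨learnable_sum_rateApprox U hS hP a, fun N hN => N.mcm.abs_sum_rate_sub_le hN S P a⟩
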